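/- Let $p=2$ or $p=3$. Let $B$ be a regular local ring (in particular noetherian), and let $G$ be a cyclic group of order $p$ acting on $B$ by (local) ring automorphisms. Let $\sigma$ be a generator of $G$, and let $I_G\subset B$ be the augmentation ideal, i.e. the ideal of $B$ generated by the elements $\sigma(b)-b$ with $b\in B$ (it does not depend on the choice of $\sigma$). If the ring of invariants $A=B^G$ is a regular local ring, then $I_G$ is a principal ideal of $B$. -/

import Mathlib

/-- The augmentation map `I_σ = σ - id : B → B`, `b ↦ σ(b) - b`, of an element `σ` of a group `G`
acting on a commutative ring `B` by ring automorphisms. -/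
def augmentationMap {G : Type*} (B : Type*) [Group G] [CommRing B] [MulSemiringAction G B]
    (σ : G) (b : B) : B :=
  σ • b - b

/-- The augmentation ideal: the ideal of `B` generated by the image of the augmentation map `I_σ`.
For a cyclic group `G` generated by `σ` this is the ideal `I_G`. -/
def augmentationIdeal {G : Type*} (B : Type*) [Group G] [CommRing B] [MulSemiringAction G B]
    (σ : G) : Ideal B :=
  Ideal.span (Set.range (augmentationMap B σ))

/-! Write A for the ring of invariants and J = m_A B. If B = A[β], the twisted Leibniz rule shows
that σ(β) - β generates the augmentation ideal, so it suffices that B is monogenic over A. If σ acts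
nontrivially, traces embed B into A^p (`traceVector_injective`), so B is finite over A, free by
miracle flatness (`IsRegularLocalRing.free_of_finite`), and of rank at most 3. Hence B/J has
dimension at most 3 over the residue field of A. If J = m_B, it is a field extension of degree 1, 2
or 3, hence simple. Otherwise the residue field does not grow, and B is monogenic as soon as one
element generates m_B modulo J. The only other possibility is m_B^2 ≤ J with m_B/J generated by two
elements. But J is generated by dim A ≤ dim B elements; cutting by elements of J outside m_B^2
reduces to J = m_B^2 with dim B = 2, where m_B^2 needs three generators. -/

open IsLocalRing

/-! ### Exchange of generators over a local ring. -/

section Exchange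

variable {R : Type*} [CommRing R] [IsLocalRing R]

/-- Some coefficient of `a` on the generators must be a unit, so that generator can be solved for.
-/
lemma Ideal.exists_span_eq_span_insert_erase [DecidableEq R] {s : Finset R} {a : R}
    (ha : a ∈ Ideal.span (s : Set R)) (ha' : a ∉ maximalIdeal R * Ideal.span (s : Set R)) :
    ∃ x ∈ s, Ideal.span (s : Set R) = Ideal.span (insert a (s.erase x) : Finset R) := by
  obtain ⟨c, -, hc⟩ := Submodule.mem_span_finset.mp ha
  obtain ⟨x, hxs, hx⟩ : ∃ x ∈ s, IsUnit (c x) := by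
    by_contra! h
    refine ha' (hc ▸ Ideal.sum_mem _ fun x hx ↦ ?_)
    exact Ideal.mul_mem_mul ((mem_maximalIdeal _).mpr (h x hx)) (Ideal.subset_span hx)
  refine ⟨x, hxs, le_antisymm (Ideal.span_le.mpr fun y hy ↦ ?_) (Ideal.span_le.mpr fun y hy ↦ ?_)⟩
  · by_cases hyx : y = x
    · subst hyx
      rw [SetLike.mem_coe, ← Ideal.unit_mul_mem_iff_mem _ hx]
      have : c y * y = a - ∑ z ∈ s.erase y, c z * z := by
        rw [← hc, ← Finset.add_sum_erase s _ hxs]; simp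
      rw [this]
      refine Ideal.sub_mem _ (Ideal.subset_span (by simp)) (Ideal.sum_mem _ fun z hz ↦ ?_)
      exact Ideal.mul_mem_left _ _ (Ideal.subset_span (by simp [Finset.mem_of_mem_erase hz,
        Finset.ne_of_mem_erase hz]))
    · exact Ideal.subset_span (by simp [hyx, Finset.mem_coe.mp hy])
  · rcases Finset.mem_insert.mp (Finset.mem_coe.mp hy) with rfl | hy
    · exact ha
    · exact Ideal.subset_span (Finset.mem_of_mem_erase hy)

lemma Ideal.exists_card_lt_span_eq_map_mk {s : Finset R} {a : R}
    (ha : a ∈ Ideal.span (s : Set R)) (ha' : a ∉ maximalIdeal R * Ideal.span (s : Set R)) :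
    ∃ t : Finset (R ⧸ Ideal.span {a}), t.card + 1 ≤ s.card ∧
      Ideal.span (t : Set (R ⧸ Ideal.span {a})) =
        (Ideal.span (s : Set R)).map (Ideal.Quotient.mk (Ideal.span {a})) := by
  classical
  obtain ⟨x, hx, h⟩ := Ideal.exists_span_eq_span_insert_erase ha ha'
  refine ⟨(s.erase x).image (Ideal.Quotient.mk (Ideal.span {a})), ?_, ?_⟩
  · have := Finset.card_image_le (s := s.erase x) (f := Ideal.Quotient.mk (Ideal.span {a}))
    rw [Finset.card_erase_of_mem hx] at this
    have := Finset.card_pos.mpr ⟨x, hx⟩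
    omega
  · rw [h, Ideal.map_span, Finset.coe_insert, Set.image_insert_eq, Ideal.span_insert,
      Finset.coe_image]
    simp

end Exchange

/-! ### Regular local rings: cutting by a parameter, integrality, regular sequences. -/

namespace IsRegularLocalRing

variable {R : Type*} [CommRing R]

lemma isLocalRing_quotient_span_singleton [IsLocalRing R] {a : R} (ha : a ∈ maximalIdeal R) :
    IsLocalRing (R ⧸ Ideal.span {a}) := by
  have : Nontrivial (R ⧸ Ideal.span {a}) := Ideal.Quotient.nontrivial_iff.mpr
    (by simpa [Ideal.span_singleton_eq_top] using ha)
  exact IsLocalRing.of_surjective' _ Ideal.Quotient.mk_surjective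

lemma map_mk_maximalIdeal [IsLocalRing R] (I : Ideal R) [IsLocalRing (R ⧸ I)] :
    (maximalIdeal R).map (Ideal.Quotient.mk I) = maximalIdeal (R ⧸ I) :=
  IsLocalRing.map_maximalIdeal_of_surjective _ Ideal.Quotient.mk_surjective

lemma exists_finset_span_eq_maximalIdeal [IsRegularLocalRing R] :
    ∃ s : Finset R, Ideal.span (s : Set R) = maximalIdeal R ∧
      (s.card : WithBot ℕ∞) = ringKrullDim R := by
  obtain ⟨s, hs, h⟩ := Submodule.FG.exists_span_finset_card_eq_spanFinrank
    (maximalIdeal R).fg_of_isNoetherianRing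
  refine ⟨s, h, ?_⟩
  rw [hs]
  exact spanFinrank_maximalIdeal

lemma exists_ringKrullDim_eq [IsRegularLocalRing R] : ∃ n : ℕ, ringKrullDim R = n :=
  ⟨_, spanFinrank_maximalIdeal.symm⟩

/-- Passing to the quotient saves at least one generator of the maximal ideal and costs at most one
dimension; regularity of `R` forces equality in both. -/
lemma quotient_span_singleton [IsRegularLocalRing R] {a : R} (ha : a ∈ maximalIdeal R)
    (ha' : a ∉ maximalIdeal R ^ 2) : IsRegularLocalRing (R ⧸ Ideal.span {a}) ∧
      ringKrullDim (R ⧸ Ideal.span {a}) + 1 = ringKrullDim R := by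
  have := isLocalRing_quotient_span_singleton ha
  obtain ⟨s, hs, hcard⟩ := exists_finset_span_eq_maximalIdeal (R := R)
  obtain ⟨t, htc, ht⟩ := Ideal.exists_card_lt_span_eq_map_mk (s := s) (a := a) (hs ▸ ha)
    (by rwa [hs, ← pow_two])
  rw [hs, map_mk_maximalIdeal] at ht
  have h1 : ringKrullDim R ≤ ringKrullDim (R ⧸ Ideal.span {a}) + 1 := by
    have := ringKrullDim_le_ringKrullDim_quotient_add_card {a}
      (by simpa [IsLocalRing.ringJacobson_eq_maximalIdeal] using ha)
    rwa [Finset.coe_singleton, Finset.card_singleton, Nat.cast_one] at this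
  have h2 : (maximalIdeal (R ⧸ Ideal.span {a})).spanFinrank + 1 ≤ s.card := by
    refine le_trans (Nat.succ_le_succ ?_) htc
    rw [← ht]
    exact (Submodule.spanFinrank_span_le_ncard_of_finite t.finite_toSet).trans (by simp)
  have h3 := ringKrullDim_le_spanFinrank_maximalIdeal (R ⧸ Ideal.span {a})
  have h4 : ((maximalIdeal (R ⧸ Ideal.span {a})).spanFinrank : WithBot ℕ∞) + 1 ≤ ringKrullDim R := by
    rw [← hcard]; exact_mod_cast h2
  have h5 : ringKrullDim (R ⧸ Ideal.span {a}) + 1 = ringKrullDim R :=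
    le_antisymm ((add_le_add_left h3 1).trans h4) h1
  refine ⟨of_spanFinrank_maximalIdeal_le _ ?_, h5⟩
  exact ENat.WithBot.add_le_add_one_right_iff.mp (h4.trans h1)

lemma ringKrullDim_eq_zero_iff_of_isRegularLocalRing [IsRegularLocalRing R] :
    ringKrullDim R = 0 ↔ maximalIdeal R = ⊥ := by
  rw [← spanFinrank_maximalIdeal, Nat.cast_eq_zero,
    Submodule.spanFinrank_eq_zero_iff_eq_bot (maximalIdeal R).fg_of_isNoetherianRing]

lemma not_maximalIdeal_le_sq [IsLocalRing R] [IsNoetherianRing R] (h : maximalIdeal R ≠ ⊥) :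
    ¬ maximalIdeal R ≤ maximalIdeal R ^ 2 := fun hle ↦ h <|
  Submodule.eq_bot_of_le_smul_of_le_jacobson_bot (maximalIdeal R) _
    (maximalIdeal R).fg_of_isNoetherianRing (by rwa [smul_eq_mul, ← pow_two])
    (maximalIdeal_le_jacobson _)

/-- Prime avoidance for the square of the maximal ideal and finitely many non-maximal primes. -/
lemma exists_mem_maximalIdeal_notMem_sq [IsLocalRing R] [IsNoetherianRing R]
    (h : maximalIdeal R ≠ ⊥) {S : Set (Ideal R)} (hS : S.Finite) (hp : ∀ P ∈ S, P.IsPrime)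
    (hm : maximalIdeal R ∉ S) :
    ∃ a ∈ maximalIdeal R, a ∉ maximalIdeal R ^ 2 ∧ ∀ P ∈ S, a ∉ P := by
  by_contra! hcon
  have hsub : (maximalIdeal R : Set R) ⊆ ⋃ I ∈ insert (maximalIdeal R ^ 2) S, (I : Set R) := by
    intro a ha
    by_cases ha2 : a ∈ maximalIdeal R ^ 2
    · exact Set.mem_biUnion (Set.mem_insert _ _) ha2
    · obtain ⟨P, hP, haP⟩ := hcon a ha ha2
      exact Set.mem_biUnion (Set.mem_insert_of_mem _ hP) haP
  -- Prime avoidance tolerates two ideals that are not prime; m^2 fills both slots.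
  obtain ⟨I, hI, hle⟩ := (Ideal.subset_union_prime_finite (f := id) (hS.insert _)
    (maximalIdeal R ^ 2) (maximalIdeal R ^ 2) (fun i hi h1 _ ↦ hp i (hi.resolve_left h1))).mp hsub
  rcases hI with rfl | hI
  · exact not_maximalIdeal_le_sq h hle
  · have := hp I hI
    have : I = maximalIdeal R := le_antisymm (le_maximalIdeal this.ne_top) hle
    exact hm (this ▸ hI)

/-- Cut by a parameter `a` outside every minimal prime. By induction (a) is prime, so it contains a
minimal prime q; as `a` is not in q, q = aq, and Nakayama gives q = 0. -/
theorem isDomain [IsRegularLocalRing R] : IsDomain R := by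
  obtain ⟨n, hn⟩ := exists_ringKrullDim_eq (R := R)
  induction n generalizing R with
  | zero =>
    have h0 := ringKrullDim_eq_zero_iff_of_isRegularLocalRing.mp (by simpa using hn)
    exact ((IsLocalRing.isField_iff_maximalIdeal_eq).mpr h0).isDomain
  | succ n ih =>
    have hbot : maximalIdeal R ≠ ⊥ := by
      rw [ne_eq, ← ringKrullDim_eq_zero_iff_of_isRegularLocalRing, hn]
      exact_mod_cast Nat.succ_ne_zero n
    have hmin : maximalIdeal R ∉ minimalPrimes R := by
      intro hmem
      have := Ideal.height_eq_zero_iff.mpr hmem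
      have h := IsLocalRing.maximalIdeal_height_eq_ringKrullDim (R := R)
      rw [this, hn] at h
      exact absurd h.symm (by exact_mod_cast Nat.succ_ne_zero n)
    obtain ⟨a, ha, ha2, haP⟩ := exists_mem_maximalIdeal_notMem_sq hbot
      (minimalPrimes.finite_of_isNoetherianRing R) (fun P hP ↦ hP.1.1) hmin
    obtain ⟨h1, h2⟩ := quotient_span_singleton ha ha2
    have hd : ringKrullDim (R ⧸ Ideal.span {a}) = n := by
      rw [hn] at h2
      push_cast at h2
      exact ENat.WithBot.add_one_cancel.mp h2
    have := ih hd
    have hprime : (Ideal.span {a}).IsPrime := (Ideal.Quotient.isDomain_iff_prime _).mp this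
    obtain ⟨q, hq, hqa⟩ := Ideal.exists_minimalPrimes_le (I := ⊥) (J := Ideal.span {a}) bot_le
    have hqp : q.IsPrime := hq.1.1
    have haq : a ∉ q := haP q hq
    have : q = ⊥ := by
      refine Submodule.eq_bot_of_le_smul_of_le_jacobson_bot (maximalIdeal R) _
        q.fg_of_isNoetherianRing (fun y hy ↦ ?_) (maximalIdeal_le_jacobson _)
      obtain ⟨z, rfl⟩ := Ideal.mem_span_singleton.mp (hqa hy)
      exact Ideal.mul_mem_mul ha ((hqp.mem_or_mem hy).resolve_left haq)
    subst this
    exact IsDomain.of_bot_isPrime R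

open RingTheory.Sequence in
theorem exists_isRegular [IsRegularLocalRing R] {n : ℕ} (hn : ringKrullDim R = n) :
    ∃ rs : List R, rs.length = n ∧ (∀ r ∈ rs, r ∈ maximalIdeal R) ∧ IsRegular R rs := by
  induction n generalizing R with
  | zero => exact ⟨[], rfl, by simp, IsRegular.nil R R⟩
  | succ n ih =>
    have := isDomain (R := R)
    have hbot : maximalIdeal R ≠ ⊥ := by
      rw [ne_eq, ← ringKrullDim_eq_zero_iff_of_isRegularLocalRing, hn]
      exact_mod_cast Nat.succ_ne_zero n
    obtain ⟨a, ha, ha2⟩ := SetLike.not_le_iff_exists.mp (not_maximalIdeal_le_sq hbot)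
    obtain ⟨h1, h2⟩ := quotient_span_singleton ha ha2
    have hd : ringKrullDim (R ⧸ Ideal.span {a}) = n := by
      rw [hn] at h2
      push_cast at h2
      exact ENat.WithBot.add_one_cancel.mp h2
    obtain ⟨rs, hlen, hmem, hreg⟩ := ih hd
    obtain ⟨rs, rfl⟩ : ∃ l : List R, l.map (Ideal.Quotient.mk (Ideal.span {a})) = rs :=
      Set.mem_range.mp <| by rw [Set.range_list_map, Ideal.Quotient.mk_surjective.range_eq]; simp
    have ha0 : a ≠ 0 := fun h ↦ ha2 (h ▸ zero_mem _)
    have hmem' : ∀ r ∈ a :: rs, r ∈ maximalIdeal R := by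
      intro r hr
      rcases List.mem_cons.mp hr with rfl | hr
      · exact ha
      · have := hmem _ (List.mem_map_of_mem hr)
        rw [mem_maximalIdeal, mem_nonunits_iff] at this ⊢
        exact fun hu ↦ this (hu.map _)
    refine ⟨a :: rs, by simpa using hlen, hmem', .of_isWeaklyRegular_of_mem_maximalIdeal _ hmem' ?_⟩
    rw [isWeaklyRegular_cons_iff']
    refine ⟨IsSMulRegular.of_ne_zero ha0, ?_⟩
    have e : (R ⧸ Ideal.span {a}) ≃ₗ[R] QuotSMulTop a R :=
      Submodule.quotEquivOfEq _ _ (by simp [← Submodule.ideal_span_singleton_smul])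
    have e' := e.extendScalarsOfSurjective (S := R ⧸ Ideal.span {a}) Ideal.Quotient.mk_surjective
    exact (e'.isWeaklyRegular_congr _).mp hreg.1

end IsRegularLocalRing

/-! ### Depth through Ext, and miracle flatness. -/

section Depth

universe u

open RingTheory.Sequence CategoryTheory Abelian Limits Pointwise

lemma subsingleton_ext_quotSMulTop {R : Type u} [CommRing R] {N M : ModuleCat.{u} R} {n : ℕ} {x : R}
    (hx : IsSMulRegular M x) (h : ∀ i < n + 1, Subsingleton (Ext N M i)) :
    ∀ i < n, Subsingleton (Ext N (ModuleCat.of R (QuotSMulTop x M)) i) := by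
  intro i hi
  have zero1 := AddCommGrpCat.isZero_of_iff_subsingleton.mpr (h i (by omega))
  have zero2 := AddCommGrpCat.isZero_of_iff_subsingleton.mpr (h (i + 1) (by omega))
  exact AddCommGrpCat.subsingleton_of_isZero <| ShortComplex.Exact.isZero_of_both_zeros
    ((Ext.covariant_sequence_exact₃' N hx.smulShortComplex_shortExact) i (i + 1) rfl)
    (zero1.eq_zero_of_src _) (zero2.eq_zero_of_tgt _)

lemma IsLocalRing.maximalIdeal_smul_top_lt_top {R M : Type*} [CommRing R] [IsLocalRing R]
    [AddCommGroup M] [Module R M] [Module.Finite R M] [Nontrivial M] {I : Ideal R}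
    (hI : I ≤ maximalIdeal R) : I • (⊤ : Submodule R M) < ⊤ :=
  (Submodule.top_ne_ideal_smul_of_le_jacobson_annihilator
    (hI.trans (maximalIdeal_le_jacobson _))).symm.lt_top

/-- A module of maximal depth is free: cut by some `a` that is regular on M and lies outside m^2, so
that A/a stays regular, and lift freeness from M/aM. Since `a` need not belong to `rs`, the depth of
M/aM is recovered from the vanishing of Ext. -/
theorem IsRegularLocalRing.free_of_isWeaklyRegular {A : Type u} [CommRing A] [IsRegularLocalRing A]
    {M : Type u} [AddCommGroup M] [Module A M] [Module.Finite A M] [Nontrivial M] {n : ℕ}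
    (hn : ringKrullDim A = n) {rs : List A} (hlen : rs.length = n)
    (hmem : ∀ r ∈ rs, r ∈ maximalIdeal A) (hreg : IsWeaklyRegular M rs) : Module.Free A M := by
  induction n generalizing A M with
  | zero =>
    have h0 := ringKrullDim_eq_zero_iff_of_isRegularLocalRing.mp (by simpa using hn)
    let := ((IsLocalRing.isField_iff_maximalIdeal_eq).mpr h0).toField
    exact Module.Free.of_divisionRing A M
  | succ n ih =>
    have hbot : maximalIdeal A ≠ ⊥ := by
      rw [ne_eq, ← ringKrullDim_eq_zero_iff_of_isRegularLocalRing, hn]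
      exact_mod_cast Nat.succ_ne_zero n
    have hass : maximalIdeal A ∉ associatedPrimes A M := by
      intro hm
      obtain ⟨r, rs', rfl⟩ := List.exists_cons_of_length_eq_add_one hlen
      have h1 := ((isWeaklyRegular_cons_iff _ _ _).mp hreg).1
      have h2 : r ∈ ⋃ p ∈ associatedPrimes A M, (p : Set A) :=
        Set.mem_biUnion hm (hmem r (by simp))
      rw [biUnion_associatedPrimes_eq_compl_regular] at h2
      exact h2 h1
    obtain ⟨a, ha, ha2, haP⟩ := exists_mem_maximalIdeal_notMem_sq hbot
      (associatedPrimes.finite A M) (fun P hP ↦ hP.isPrime) hass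
    have hareg : IsSMulRegular M a := by
      by_contra hcon
      have : a ∈ ⋃ p ∈ associatedPrimes A M, (p : Set A) := by
        rw [biUnion_associatedPrimes_eq_compl_regular]; exact hcon
      obtain ⟨P, hP, haP'⟩ := Set.mem_iUnion₂.mp this
      exact haP P hP haP'
    obtain ⟨h1, h2⟩ := quotient_span_singleton ha ha2
    have hd : ringKrullDim (A ⧸ Ideal.span {a}) = n := by
      rw [hn] at h2
      push_cast at h2
      exact ENat.WithBot.add_one_cancel.mp h2
    have hsupp : Module.support A (A ⧸ maximalIdeal A) =
        PrimeSpectrum.zeroLocus (maximalIdeal A) := by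
      rw [Module.support_eq_zeroLocus, Ideal.annihilator_quotient]
    have hext := ModuleCat.subsingleton_ext_of_exists_isRegular (maximalIdeal A)
      (ModuleCat.of A (A ⧸ maximalIdeal A)) hsupp.subset (ModuleCat.of A M)
      (maximalIdeal_smul_top_lt_top le_rfl) rs hmem
      (.of_isWeaklyRegular_of_mem_maximalIdeal _ hmem hreg)
    rw [hlen] at hext
    have := nontrivial_quotSMulTop_of_mem_maximalIdeal M ha
    have hext' := subsingleton_ext_quotSMulTop (M := ModuleCat.of A M) hareg hext
    obtain ⟨rs', hlen', hmem', hreg'⟩ := ModuleCat.exists_isRegular_of_exists_subsingleton_ext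
      (maximalIdeal A) n (ModuleCat.of A (QuotSMulTop a M)) (maximalIdeal_smul_top_lt_top le_rfl)
      (ModuleCat.of A (A ⧸ maximalIdeal A)) hsupp hext'
    have : Module.Finite (A ⧸ Ideal.span {a}) (QuotSMulTop a M) :=
      Module.Finite.of_restrictScalars_finite A _ _
    have hfree : Module.Free (A ⧸ Ideal.span {a}) (QuotSMulTop a M) := by
      refine ih hd (rs := rs'.map (algebraMap A (A ⧸ Ideal.span {a}))) (by simpa using hlen') ?_
        ((isWeaklyRegular_map_algebraMap_iff _ _ _).mpr hreg'.1)
      intro r hr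
      obtain ⟨s, hs, rfl⟩ := List.mem_map.mp hr
      rw [← map_mk_maximalIdeal]
      exact Ideal.mem_map_of_mem _ (hmem' s hs)
    have := Module.finitePresentation_of_finite A M
    exact (Module.free_quotSMulTop_iff_free A M (maximalIdeal_le_jacobson _ ha) hareg).mp hfree

variable {A B : Type u} [CommRing A] [CommRing B] [Algebra A B] [Module.Finite A B]

/-- An A-linear map A/I → M is an element killed by I, hence by IB, so it comes from a B-linear map
B/IB → M. This lets the regular element be chosen in A. -/
lemma exists_isSMulRegular_algebraMap_of_subsingleton_hom [IsNoetherianRing A] (I : Ideal A)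
    (M : Type*) [AddCommGroup M] [Module B M] [Module.Finite B M]
    (h : Subsingleton ((B ⧸ I.map (algebraMap A B)) →ₗ[B] M)) :
    ∃ a ∈ I, IsSMulRegular M (algebraMap A B a) := by
  let : Module A M := Module.compHom M (algebraMap A B)
  have : IsScalarTower A B M := ⟨fun a b m ↦ by
    rw [Algebra.smul_def, mul_smul]; rfl⟩
  have : Module.Finite A M := Module.Finite.trans B M
  have hsub : Subsingleton ((A ⧸ I) →ₗ[A] M) := by
    refine subsingleton_of_forall_eq 0 fun f ↦ ?_
    set v := f (Ideal.Quotient.mk I 1) with hv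
    have hle : I.map (algebraMap A B) ≤ LinearMap.ker (LinearMap.toSpanSingleton B M v) := by
      rw [Ideal.map_le_iff_le_comap]
      intro a ha
      rw [Ideal.mem_comap, LinearMap.mem_ker, LinearMap.toSpanSingleton_apply, algebraMap_smul, hv,
        ← map_smul, ← Ideal.Quotient.mkₐ_eq_mk A, ← map_smul, smul_eq_mul, mul_one,
        Ideal.Quotient.mkₐ_eq_mk, Ideal.Quotient.eq_zero_iff_mem.mpr ha, map_zero]
    have h0 := LinearMap.congr_fun (Subsingleton.elim (Submodule.liftQ _ _ hle) 0)
      (Submodule.Quotient.mk 1)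
    have hv0 : v = 0 := by
      rwa [Submodule.liftQ_apply, LinearMap.toSpanSingleton_apply, one_smul] at h0
    ext
    simpa [hv] using hv0
  obtain ⟨r, hr, hreg⟩ := IsSMulRegular.subsingleton_linearMap_iff.mp hsub
  rw [Ideal.annihilator_quotient] at hr
  exact ⟨r, hr, fun x y hxy ↦ hreg (by simpa using hxy)⟩

lemma exists_isWeaklyRegular_map_of_subsingleton_ext [IsNoetherianRing A]
    (I : Ideal A) (n : ℕ) (M : ModuleCat.{u} B) [Module.Finite B M]
    (h : ∀ i < n, Subsingleton (Ext (ModuleCat.of B (B ⧸ I.map (algebraMap A B))) M i)) :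
    ∃ rs : List A, rs.length = n ∧ (∀ r ∈ rs, r ∈ I) ∧
      IsWeaklyRegular M (rs.map (algebraMap A B)) := by
  induction n generalizing M with
  | zero => exact ⟨[], rfl, by simp, by simp⟩
  | succ n ih =>
    have h0 : Subsingleton ((ModuleCat.of B (B ⧸ I.map (algebraMap A B))) ⟶ M) :=
      Ext.addEquiv₀.subsingleton_congr.mp (h 0 n.zero_lt_succ)
    have h1 : Subsingleton ((B ⧸ I.map (algebraMap A B)) →ₗ[B] M) :=
      (ModuleCat.homAddEquiv (M := ModuleCat.of B (B ⧸ I.map (algebraMap A B)))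
        (N := M)).symm.subsingleton
    obtain ⟨a, ha, hreg⟩ := exists_isSMulRegular_algebraMap_of_subsingleton_hom I M h1
    obtain ⟨rs, hlen, hmem, hrs⟩ := ih _ (subsingleton_ext_quotSMulTop hreg h)
    refine ⟨a :: rs, by simpa using hlen, by simpa using ⟨ha, hmem⟩, ?_⟩
    rw [List.map_cons, isWeaklyRegular_cons_iff]
    exact ⟨hreg, hrs⟩

lemma IsLocalRing.eq_maximalIdeal_of_map_maximalIdeal_le {A B : Type*} [CommRing A] [CommRing B]
    [Algebra A B] [Algebra.IsIntegral A B] [IsLocalRing A] [IsLocalRing B] {P : Ideal B} [P.IsPrime]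
    (h : (maximalIdeal A).map (algebraMap A B) ≤ P) :
    P = maximalIdeal B := by
  have h1 : P.comap (algebraMap A B) = maximalIdeal A :=
    ((maximalIdeal.isMaximal A).eq_of_le (Ideal.IsPrime.ne_top inferInstance)
      (Ideal.map_le_iff_le_comap.mp h)).symm
  have h2 : (P.comap (algebraMap A B)).IsMaximal := h1 ▸ inferInstance
  exact IsLocalRing.eq_maximalIdeal (Ideal.isMaximal_of_isIntegral_of_isMaximal_comap P h2)

/-- Depth over B transfers to A: m_B is the only prime containing m_A B, so a regular sequence in
m_B kills the low Ext groups out of B/m_A B. -/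
lemma exists_isWeaklyRegular_of_isRegular [IsNoetherianRing A] [IsLocalRing A] [IsLocalRing B]
    {bs : List B} (hmem : ∀ b ∈ bs, b ∈ maximalIdeal B) (hreg : IsRegular B bs) :
    ∃ rs : List A, rs.length = bs.length ∧ (∀ r ∈ rs, r ∈ maximalIdeal A) ∧
      IsWeaklyRegular B rs := by
  have : IsNoetherianRing B := IsNoetherianRing.of_finite A B
  have hsupp : Module.support B (B ⧸ (maximalIdeal A).map (algebraMap A B)) ⊆
      PrimeSpectrum.zeroLocus (maximalIdeal B) := by
    rw [Module.support_eq_zeroLocus, Ideal.annihilator_quotient]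
    intro P hP
    exact (eq_maximalIdeal_of_map_maximalIdeal_le (A := A) hP).ge
  obtain ⟨rs, h1, h2, h3⟩ := exists_isWeaklyRegular_map_of_subsingleton_ext (maximalIdeal A) bs.length
    (ModuleCat.of B B) (ModuleCat.subsingleton_ext_of_exists_isRegular (maximalIdeal B)
      (ModuleCat.of B (B ⧸ (maximalIdeal A).map (algebraMap A B))) hsupp (ModuleCat.of B B)
      (maximalIdeal_smul_top_lt_top le_rfl) bs hmem hreg)
  exact ⟨rs, h1, h2, (isWeaklyRegular_map_algebraMap_iff B B rs).mp h3⟩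


lemma ringKrullDim_le_of_hasGoingUp {A B : Type*} [CommRing A] [CommRing B] [Algebra A B]
    [Algebra.IsIntegral A B] [FaithfulSMul A B] : ringKrullDim A ≤ ringKrullDim B := by
  refine iSup_le fun l ↦ ?_
  obtain ⟨⟨P, hP, hPl⟩⟩ := Ideal.nonempty_primesOver (S := B) l.head.asIdeal
  obtain ⟨L, hL, -⟩ := Ideal.exists_ltSeries_of_hasGoingUp l P
  rw [← hL]
  exact le_iSup (fun L : LTSeries (PrimeSpectrum B) ↦ (L.length : WithBot ℕ∞)) L

/-- Miracle flatness for a module-finite extension of regular local rings. -/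
theorem IsRegularLocalRing.free_of_finite [IsRegularLocalRing A] [IsRegularLocalRing B]
    [FaithfulSMul A B] : Module.Free A B := by
  obtain ⟨n, hn⟩ := exists_ringKrullDim_eq (R := A)
  obtain ⟨m, hm⟩ := exists_ringKrullDim_eq (R := B)
  have hnm : n ≤ m := by
    have := ringKrullDim_le_of_hasGoingUp (A := A) (B := B)
    rw [hn, hm] at this
    exact_mod_cast this
  obtain ⟨bs, hlen, hmem, hreg⟩ := exists_isRegular hm
  obtain ⟨rs, hlen', hmem', hreg'⟩ := exists_isWeaklyRegular_of_isRegular (A := A) hmem hreg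
  -- The sequence has length dim B; an initial segment of length dim A suffices, so equality of
  -- dimensions is not needed.
  refine free_of_isWeaklyRegular hn (rs := rs.take n) (by simp [hlen', hlen, hnm])
    (fun r hr ↦ hmem' r (List.mem_of_mem_take hr)) ?_
  rw [← List.take_append_drop n rs, isWeaklyRegular_append_iff] at hreg'
  exact hreg'.1

end Depth

/-! ### Ideals with few generators that contain m^2. -/

lemma Ideal.exists_span_pair_eq_of_card_le_two {R : Type*} [CommRing R] {s : Finset R}
    (hs : s.card ≤ 2) :
    ∃ u v, Ideal.span (s : Set R) = Ideal.span {u, v} := by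
  classical
  rcases Nat.lt_or_ge s.card 2 with h | h
  · rcases Finset.card_le_one_iff_subset_singleton.mp (Nat.lt_succ_iff.mp h) with ⟨u, hu⟩
    rcases Finset.subset_singleton_iff.mp hu with rfl | rfl
    · exact ⟨0, 0, by simp⟩
    · exact ⟨u, u, by simp⟩
  · obtain ⟨u, v, -, rfl⟩ := Finset.card_eq_two.mp (le_antisymm hs h)
    exact ⟨u, v, by simp⟩

namespace IsRegularLocalRing

variable {R : Type*} [CommRing R] [IsRegularLocalRing R]

lemma ringKrullDim_le_card_of_span_eq {s : Finset R}
    (hs : Ideal.span (s : Set R) = maximalIdeal R) : ringKrullDim R ≤ s.card := by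
  refine (ringKrullDim_le_spanFinrank_maximalIdeal R).trans (Nat.cast_le.mpr ?_)
  rw [← hs]
  exact (Submodule.spanFinrank_span_le_ncard_of_finite s.finite_toSet).trans (by simp)

/-- If x were in m^2, Nakayama would make y alone generate m, contradicting dimension two. So R/x is
regular, hence a domain. -/
lemma prime_of_span_pair_eq (h : ringKrullDim R = 2) {x y : R}
    (hxy : Ideal.span {x, y} = maximalIdeal R) : Prime x ∧ ¬ x ∣ y := by
  have := isDomain (R := R)
  have hne : ∀ z : R, Ideal.span {z} ≠ maximalIdeal R := by
    intro z hz
    have := ringKrullDim_le_card_of_span_eq (s := {z}) (by simpa using hz)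
    rw [h] at this
    exact absurd this (by simp)
  have hx : x ∈ maximalIdeal R := hxy ▸ Ideal.subset_span (by simp)
  have hdvd : ¬ x ∣ y := by
    rintro ⟨c, rfl⟩
    refine hne x (hxy ▸ ?_)
    rw [Ideal.span_insert, left_eq_sup, Ideal.span_singleton_le_span_singleton]
    exact Dvd.intro c rfl
  have hx2 : x ∉ maximalIdeal R ^ 2 := by
    intro hx2
    refine hne y (le_antisymm (hxy ▸ Ideal.span_mono (by simp)) ?_)
    refine Submodule.le_of_le_smul_of_le_jacobson_bot (I := maximalIdeal R)
      (maximalIdeal R).fg_of_isNoetherianRing (maximalIdeal_le_jacobson _) ?_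
    conv_lhs => rw [← hxy]
    rw [Ideal.span_insert, sup_comm, smul_eq_mul, ← pow_two]
    exact sup_le_sup_left ((Ideal.span_singleton_le_iff_mem _).mpr hx2) _
  have := (quotient_span_singleton hx hx2).1
  have := isDomain (R := R ⧸ Ideal.span {x})
  have hx0 : x ≠ 0 := fun h0 ↦ hx2 (h0 ▸ zero_mem _)
  exact ⟨(Ideal.span_singleton_prime hx0).mp ((Ideal.Quotient.isDomain_iff_prime _).mp this), hdvd⟩

/-- The monomials of degree two in a regular system of parameters of length two are linearly
independent modulo the cube of the maximal ideal. -/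
lemma mem_maximalIdeal_of_quadratic_mem (h : ringKrullDim R = 2) {x y : R}
    (hxy : Ideal.span {x, y} = maximalIdeal R) {a b c : R}
    (habc : a * (x * x) + b * (x * y) + c * (y * y) ∈ maximalIdeal R * maximalIdeal R ^ 2) :
    a ∈ maximalIdeal R ∧ b ∈ maximalIdeal R ∧ c ∈ maximalIdeal R := by
  have := isDomain (R := R)
  obtain ⟨hx, hxy'⟩ := prime_of_span_pair_eq h hxy
  obtain ⟨hy, hyx'⟩ := prime_of_span_pair_eq h (Set.pair_comm x y ▸ hxy)
  have hxm : x ∈ maximalIdeal R := hxy ▸ Ideal.subset_span (by simp)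
  have hym : y ∈ maximalIdeal R := hxy ▸ Ideal.subset_span (by simp)
  have hsq : maximalIdeal R ^ 2 = Ideal.span {x * x, x * y, y * y} := by
    rw [pow_two, ← hxy, Ideal.span_pair_mul_span_pair, mul_comm y x, Set.insert_idem]
  rw [hsq, Ideal.span_insert, Ideal.span_insert, Ideal.mul_sup, Ideal.mul_sup] at habc
  obtain ⟨u, hu, v, hv, huv⟩ := Submodule.mem_sup.mp habc
  obtain ⟨w, hw, t, ht, rfl⟩ := Submodule.mem_sup.mp hv
  obtain ⟨a', ha', rfl⟩ := Ideal.mem_mul_span_singleton.mp hu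
  obtain ⟨b', hb', rfl⟩ := Ideal.mem_mul_span_singleton.mp hw
  obtain ⟨c', hc', rfl⟩ := Ideal.mem_mul_span_singleton.mp ht
  -- Absorbing the cubic error into the coefficients leaves an exact quadratic relation; primality
  -- of x and y then peels off the coefficients.
  obtain ⟨d, hd⟩ : x ∣ c - c' := by
    have h1 : x ∣ (c - c') * (y * y) := ⟨-((a - a') * x + (b - b') * y), by linear_combination -huv⟩
    exact (hx.dvd_or_dvd h1).resolve_right fun h2 ↦ (hx.dvd_or_dvd h2).elim hxy' hxy'
  have h0 : (a - a') * x + (b - b') * y + d * (y * y) = 0 := by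
    refine (mul_eq_zero.mp (?_ : x * _ = 0)).resolve_left hx.ne_zero
    linear_combination -huv - hd * (y * y)
  obtain ⟨e, he⟩ : y ∣ a - a' := by
    have h1 : y ∣ (a - a') * x := ⟨-((b - b') + d * y), by linear_combination h0⟩
    exact (hy.dvd_or_dvd h1).resolve_right hyx'
  obtain ⟨f, hf⟩ : x ∣ (b - b') + d * y := by
    have h1 : x ∣ ((b - b') + d * y) * y := ⟨-(a - a'), by linear_combination h0⟩
    exact (hx.dvd_or_dvd h1).resolve_right hxy'
  refine ⟨?_, ?_, ?_⟩
  · rw [eq_add_of_sub_eq' he]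
    exact add_mem ha' (Ideal.mul_mem_right _ _ hym)
  · have : b = b' + (x * f - y * d) := by linear_combination hf
    rw [this]
    exact add_mem hb' (sub_mem (Ideal.mul_mem_right _ _ hxm) (Ideal.mul_mem_right _ _ hym))
  · rw [eq_add_of_sub_eq' hd]
    exact add_mem hc' (Ideal.mul_mem_right _ _ hxm)

/-- Three combinations of u and v satisfy a linear relation, while x^2, xy, y^2 are independent
modulo m^3. -/
lemma maximalIdeal_sq_ne_span_pair (h : ringKrullDim R = 2) (u v : R) :
    maximalIdeal R ^ 2 ≠ Ideal.span {u, v} := by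
  intro huv
  classical
  obtain ⟨s, hs, hcard⟩ := exists_finset_span_eq_maximalIdeal (R := R)
  rw [h] at hcard
  obtain ⟨x, y, -, rfl⟩ := Finset.card_eq_two.mp (by exact_mod_cast hcard : s.card = 2)
  rw [Finset.coe_pair] at hs
  have hx : x ∈ maximalIdeal R := hs ▸ Ideal.subset_span (by simp)
  have hy : y ∈ maximalIdeal R := hs ▸ Ideal.subset_span (by simp)
  have hu : u ∈ maximalIdeal R ^ 2 := huv ▸ Ideal.subset_span (by simp)
  have hv : v ∈ maximalIdeal R ^ 2 := huv ▸ Ideal.subset_span (by simp)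
  have key : ∀ {p q}, p ∈ maximalIdeal R → q ∈ maximalIdeal R → ∃ a b, a * u + b * v = p * q :=
    fun hp hq ↦ Ideal.mem_span_pair.mp (huv ▸ pow_two (maximalIdeal R) ▸ Ideal.mul_mem_mul hp hq)
  obtain ⟨a₁, b₁, h₁⟩ := key hx hx
  obtain ⟨a₂, b₂, h₂⟩ := key hx hy
  obtain ⟨a₃, b₃, h₃⟩ := key hy hy
  have hdet : a₁ * b₂ - a₂ * b₁ ∈ maximalIdeal R := by
    -- The coefficients are the 2×2 minors of the matrix expressing x^2, xy, y^2 in u, v.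
    refine (mem_maximalIdeal_of_quadratic_mem h hs (a := a₂ * b₃ - a₃ * b₂)
      (b := a₃ * b₁ - a₁ * b₃) (c := a₁ * b₂ - a₂ * b₁) ?_).2.2
    rw [← h₁, ← h₂, ← h₃]
    convert (maximalIdeal R * maximalIdeal R ^ 2).zero_mem using 1
    ring
  -- Eliminating u leaves a multiple of v by the minor just shown to lie in m; eliminating v is
  -- symmetric. So `a₁` and `b₁` lie in m, and x^2 in m^3.
  have ha := mem_maximalIdeal_of_quadratic_mem h hs (a := a₂) (b := -a₁) (c := 0) (by
    rw [← h₁, ← h₂]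
    convert neg_mem (Ideal.mul_mem_mul hdet hv) using 1
    ring)
  have hb := mem_maximalIdeal_of_quadratic_mem h hs (a := b₂) (b := -b₁) (c := 0) (by
    rw [← h₁, ← h₂]
    convert Ideal.mul_mem_mul hdet hu using 1
    ring)
  have h1 := mem_maximalIdeal_of_quadratic_mem h hs (a := 1) (b := 0) (c := 0) (by
    rw [← h₁]
    convert add_mem (Ideal.mul_mem_mul (neg_mem_iff.mp ha.2.1) hu)
      (Ideal.mul_mem_mul (neg_mem_iff.mp hb.2.1) hv) using 1
    ring)
  exact (Ideal.ne_top_iff_one _).mp (maximalIdeal.isMaximal R).ne_top h1.1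

/-- A proper ideal that contains the square of the maximal ideal and is generated by `dim R`
elements is contained in the maximal ideal with corank at most one, provided that the corank is at
most two. -/
theorem exists_sup_span_singleton_eq_maximalIdeal {n : ℕ} (hn : ringKrullDim R = n) {s : Finset R}
    (hs : s.card ≤ n) (hsq : maximalIdeal R ^ 2 ≤ Ideal.span (s : Set R)) {x y : R}
    (hxy : Ideal.span (s : Set R) ⊔ Ideal.span {x, y} = maximalIdeal R) :
    ∃ z, Ideal.span (s : Set R) ⊔ Ideal.span {z} = maximalIdeal R := by
  induction n generalizing R with
  | zero =>
    have h0 := ringKrullDim_eq_zero_iff_of_isRegularLocalRing.mp (by simpa using hn)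
    refine ⟨0, ?_⟩
    rw [h0] at hxy ⊢
    simpa using (sup_eq_bot_iff.mp hxy).1
  | succ n ih =>
    have hJm : Ideal.span (s : Set R) ≤ maximalIdeal R := hxy ▸ le_sup_left
    by_cases hJ : Ideal.span (s : Set R) ≤ maximalIdeal R ^ 2
    -- Now J = m^2, so x, y generate m by Nakayama and the dimension is at most 2. Dimension 2 is
    -- excluded by counting generators of m^2; in dimension 1, m is principal.
    · have hJ := le_antisymm hsq hJ
      have hm : Ideal.span {x, y} = maximalIdeal R := by
        refine le_antisymm (hxy ▸ le_sup_right) ?_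
        refine Submodule.le_of_le_smul_of_le_jacobson_bot (I := maximalIdeal R)
          (maximalIdeal R).fg_of_isNoetherianRing (maximalIdeal_le_jacobson _) ?_
        rw [smul_eq_mul, ← pow_two, hJ, sup_comm, hxy]
      obtain ⟨t, ht, htc⟩ := exists_finset_span_eq_maximalIdeal (R := R)
      rw [hn, Nat.cast_inj] at htc
      classical
      have hle := ringKrullDim_le_card_of_span_eq (s := {x, y}) (by simpa using hm)
      have hle : n + 1 ≤ 2 := (by
        rw [hn] at hle; exact_mod_cast hle : n + 1 ≤ Finset.card {x, y}).trans Finset.card_le_two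
      rcases Nat.lt_or_ge 0 n with h | h
      · obtain rfl : n = 1 := by omega
        obtain ⟨u, v, huv⟩ := Ideal.exists_span_pair_eq_of_card_le_two hs
        exact absurd (hJ.trans huv) (maximalIdeal_sq_ne_span_pair (by simpa using hn) u v)
      · obtain rfl : n = 0 := by omega
        obtain ⟨z, rfl⟩ := Finset.card_eq_one.mp htc
        rw [Finset.coe_singleton] at ht
        exact ⟨z, by rw [ht, sup_eq_right.mpr hJm]⟩
    -- Dividing by `a` in J outside m^2 lowers the dimension and the number of generators of J
    -- together.
    · obtain ⟨a, ha, ha2⟩ := SetLike.not_le_iff_exists.mp hJ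
      obtain ⟨t, htc, ht⟩ := Ideal.exists_card_lt_span_eq_map_mk ha fun h ↦
        ha2 (pow_two (maximalIdeal R) ▸ Ideal.mul_mono_right hJm h)
      obtain ⟨h1, h2⟩ := quotient_span_singleton (hJm ha) ha2
      have hd : ringKrullDim (R ⧸ Ideal.span {a}) = n := by
        rw [hn] at h2
        push_cast at h2
        exact ENat.WithBot.add_one_cancel.mp h2
      obtain ⟨z, hz⟩ := ih hd (s := t) (by omega)
        (by rw [← map_mk_maximalIdeal, ← Ideal.map_pow, ht]; exact Ideal.map_mono hsq)
        (x := Ideal.Quotient.mk _ x) (y := Ideal.Quotient.mk _ y) (by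
          rw [← map_mk_maximalIdeal, ht, ← hxy, Ideal.map_sup, Ideal.map_span _ {x, y},
            Set.image_pair])
      obtain ⟨z, rfl⟩ := Ideal.Quotient.mk_surjective z
      refine ⟨z, ?_⟩
      rw [← map_mk_maximalIdeal, ht, ← Set.image_singleton, ← Ideal.map_span, ← Ideal.map_sup,
        Ideal.map_eq_iff_sup_ker_eq_of_surjective _ Ideal.Quotient.mk_surjective,
        Ideal.mk_ker] at hz
      have hle : Ideal.span {a} ≤ Ideal.span (s : Set R) :=
        (Ideal.span_singleton_le_iff_mem _).mpr ha
      rwa [sup_eq_left.mpr (hle.trans le_sup_left), sup_eq_left.mpr (hle.trans hJm)] at hz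

end IsRegularLocalRing

/-! ### Monogenicity of finite free extensions of small rank. -/

lemma not_isUnit_of_algebraMap_mem {A B : Type*} [CommRing A] [CommRing B] [Algebra A B]
    [IsLocalRing B] {a : A} (h : algebraMap A B a ∈ maximalIdeal B) :
    ¬ IsUnit a := fun hu ↦ (mem_maximalIdeal _).mp h (hu.map _)

lemma algebraMap_mem_map_maximalIdeal {A B : Type*} [CommRing A] [CommRing B] [Algebra A B]
    [IsLocalRing A] {a : A} (h : ¬ IsUnit a) :
    algebraMap A B a ∈ (maximalIdeal A).map (algebraMap A B) :=
  Ideal.mem_map_of_mem _ ((mem_maximalIdeal _).mpr h)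

lemma mem_of_isUnit_of_algebraMap_mul_mem {A B : Type*} [CommRing A] [CommRing B] [Algebra A B]
    {I : Ideal B} {a : A} {b : B} (ha : IsUnit a)
    (h : algebraMap A B a * b ∈ I) : b ∈ I :=
  (Ideal.unit_mul_mem_iff_mem _ (ha.map (algebraMap A B))).mp h

section Monogenic

variable {A B : Type*} [CommRing A] [CommRing B] [Algebra A B] [IsLocalRing A] [Module.Finite A B]

lemma Algebra.adjoin_singleton_eq_top_of_forall_exists_sub_mem {β : B}
    (h : ∀ b : B, ∃ s ∈ Algebra.adjoin A {β}, b - s ∈ (maximalIdeal A).map (algebraMap A B)) :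
    Algebra.adjoin A {β} = ⊤ := by
  refine Algebra.toSubmodule_eq_top.mp (_root_.eq_top_iff.mpr ?_)
  refine Submodule.le_of_le_smul_of_le_jacobson_bot (I := maximalIdeal A)
    Module.Finite.fg_top (maximalIdeal_le_jacobson _) fun b _ ↦ ?_
  obtain ⟨s, hs, hbs⟩ := h b
  rw [Ideal.smul_top_eq_map]
  exact Submodule.mem_sup.mpr ⟨s, hs, b - s, hbs, by ring⟩

/-- Modulo J every b is a + zc with a in A; iterating expands b in powers of z, and z is nilpotent
modulo J because m_B is the only prime over J. -/
lemma Algebra.adjoin_singleton_eq_top_of_sup_span_eq [IsLocalRing B] [IsNoetherianRing B]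
    {z : B} (hz : (maximalIdeal A).map (algebraMap A B) ⊔ Ideal.span {z} = maximalIdeal B)
    (hres : ∀ b : B, ∃ a : A, b - algebraMap A B a ∈ maximalIdeal B) :
    Algebra.adjoin A {z} = ⊤ := by
  set J := (maximalIdeal A).map (algebraMap A B) with hJ
  have key : ∀ (n : ℕ) (b : B), ∃ s ∈ Algebra.adjoin A {z}, b - s ∈ J ⊔ Ideal.span {z ^ n} := by
    intro n
    induction n with
    | zero => exact fun b ↦ ⟨0, zero_mem _, by simp⟩
    | succ n ih =>
      intro b
      obtain ⟨a, ha⟩ := hres b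
      rw [← hz] at ha
      obtain ⟨j, hj, u, hu, hju⟩ := Submodule.mem_sup.mp ha
      obtain ⟨c, rfl⟩ := Ideal.mem_span_singleton.mp hu
      obtain ⟨s, hs, hcs⟩ := ih c
      obtain ⟨j', hj', u, hu, hju'⟩ := Submodule.mem_sup.mp hcs
      obtain ⟨d, rfl⟩ := Ideal.mem_span_singleton.mp hu
      refine ⟨algebraMap A B a + z * s, add_mem (Subalgebra.algebraMap_mem _ _)
        (mul_mem (Algebra.self_mem_adjoin_singleton _ _) hs), Submodule.mem_sup.mpr
        ⟨j + z * j', add_mem hj (J.mul_mem_left _ hj'), z ^ (n + 1) * d,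
          Ideal.mul_mem_right _ _ (Ideal.mem_span_singleton_self _), ?_⟩⟩
      linear_combination hju + z * hju'
  obtain ⟨n, hn⟩ : ∃ n, z ^ n ∈ J := by
    have hrad : z ∈ J.radical := by
      rw [Ideal.radical_eq_sInf, Ideal.mem_sInf]
      rintro P ⟨hP, hPp⟩
      rw [eq_maximalIdeal_of_map_maximalIdeal_le (A := A) hP, ← hz]
      exact Ideal.mem_sup_right (Ideal.mem_span_singleton_self _)
    exact hrad
  refine Algebra.adjoin_singleton_eq_top_of_forall_exists_sub_mem fun b ↦ ?_
  obtain ⟨s, hs, hbs⟩ := key n b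
  exact ⟨s, hs, by rwa [sup_eq_left.mpr ((Ideal.span_singleton_le_iff_mem _).mpr hn)] at hbs⟩

/-- B/J has dimension `finrank A B` over the residue field, so more elements than that are
dependent; lift the relation. -/
lemma exists_isUnit_sum_mul_mem_map_maximalIdeal [Module.Free A B]
    {n : ℕ} (h : Module.finrank A B < n) (b : Fin n → B) :
    ∃ a : Fin n → A, (∃ i, IsUnit (a i)) ∧
      ∑ i, algebraMap A B (a i) * b i ∈ (maximalIdeal A).map (algebraMap A B) := by
  let : Field (A ⧸ maximalIdeal A) := Ideal.Quotient.field _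
  have : Module.Finite (A ⧸ maximalIdeal A) (B ⧸ (maximalIdeal A).map (algebraMap A B)) :=
    Module.Finite.of_restrictScalars_finite A _ _
  have hdep : ¬ LinearIndependent (A ⧸ maximalIdeal A)
      fun i ↦ Ideal.Quotient.mk ((maximalIdeal A).map (algebraMap A B)) (b i) := by
    intro hli
    have := hli.fintype_card_le_finrank
    rw [finrank_quotient_map, Fintype.card_fin] at this
    omega
  obtain ⟨g, hg, i, hi⟩ := Fintype.not_linearIndependent_iff.mp hdep
  choose a ha using fun i ↦ Ideal.Quotient.mk_surjective (g i)
  refine ⟨a, ⟨i, ?_⟩, ?_⟩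
  · by_contra hu
    exact hi (ha i ▸ Ideal.Quotient.eq_zero_iff_mem.mpr ((mem_maximalIdeal _).mpr hu))
  · rw [← Ideal.Quotient.eq_zero_iff_mem, map_sum, ← hg]
    refine Finset.sum_congr rfl fun i _ ↦ ?_
    rw [← ha i, Ideal.Quotient.mk_smul_mk_quotient_map_quotient]

/-- If `B / 𝔪_A B` is a field and the rank of `B` over `A` is one or a prime, then `B` is
monogenic over `A`. -/
lemma exists_adjoin_singleton_eq_top_of_isMaximal [Module.Free A B]
    (hmax : ((maximalIdeal A).map (algebraMap A B)).IsMaximal)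
    (hrank : Module.finrank A B = 1 ∨ (Module.finrank A B).Prime) :
    ∃ β : B, Algebra.adjoin A {β} = ⊤ := by
  let : Field (A ⧸ maximalIdeal A) := Ideal.Quotient.field _
  set J := (maximalIdeal A).map (algebraMap A B) with hJ
  have : IsDomain (B ⧸ J) := Ideal.Quotient.isDomain J
  rw [← finrank_quotient_map] at hrank
  obtain ⟨c, hc⟩ : ∃ c : B ⧸ J, Algebra.adjoin (A ⧸ maximalIdeal A) {c} = ⊤ := by
    by_cases hbt : (⊥ : Subalgebra (A ⧸ maximalIdeal A) (B ⧸ J)) = ⊤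
    · exact ⟨1, by rw [Algebra.adjoin_singleton_one, hbt]⟩
    -- In prime degree there is no intermediate algebra, so any element outside the base field
    -- generates.
    · have hp := hrank.resolve_left fun h1 ↦ hbt (Subalgebra.bot_eq_top_iff_finrank_eq_one.mpr h1)
      have := Subalgebra.isSimpleOrder_of_finrank_prime _ _ hp
      obtain ⟨c, -, hc⟩ := SetLike.exists_of_lt (lt_top_iff_ne_top.mpr hbt)
      refine ⟨c, (eq_bot_or_eq_top _).resolve_left fun h ↦ hc ?_⟩
      exact h ▸ Algebra.self_mem_adjoin_singleton _ _
  obtain ⟨β, rfl⟩ := Ideal.Quotient.mk_surjective c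
  refine ⟨β, Algebra.adjoin_singleton_eq_top_of_forall_exists_sub_mem fun b ↦ ?_⟩
  have hb : Ideal.Quotient.mk J b ∈ Algebra.adjoin (A ⧸ maximalIdeal A) {Ideal.Quotient.mk J β} :=
    hc ▸ Algebra.mem_top
  suffices h : ∀ c ∈ Algebra.adjoin (A ⧸ maximalIdeal A) {Ideal.Quotient.mk J β},
      ∃ s ∈ Algebra.adjoin A {β}, Ideal.Quotient.mk J s = c by
    obtain ⟨s, hs, hsb⟩ := h _ hb
    exact ⟨s, hs, Ideal.Quotient.eq.mp hsb.symm⟩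
  intro c hc
  induction hc using Algebra.adjoin_induction with
  | mem x hx => exact ⟨β, Algebra.self_mem_adjoin_singleton _ _, hx.symm⟩
  | algebraMap r =>
    obtain ⟨a, rfl⟩ := Ideal.Quotient.mk_surjective r
    exact ⟨algebraMap A B a, Subalgebra.algebraMap_mem _ _, rfl⟩
  | add x y _ _ hx hy =>
    obtain ⟨s, hs, rfl⟩ := hx
    obtain ⟨t, ht, rfl⟩ := hy
    exact ⟨s + t, add_mem hs ht, map_add _ _ _⟩
  | mul x y _ _ hx hy =>
    obtain ⟨s, hs, rfl⟩ := hx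
    obtain ⟨t, ht, rfl⟩ := hy
    exact ⟨s * t, mul_mem hs ht, map_mul _ _ _⟩

variable [Module.Free A B]

lemma exists_isUnit_or_relation (hrank : Module.finrank A B < 4) (b₀ b₁ b₂ b₃ : B) :
    ∃ a₀ a₁ a₂ a₃ : A, (IsUnit a₀ ∨ IsUnit a₁ ∨ IsUnit a₂ ∨ IsUnit a₃) ∧
      algebraMap A B a₀ * b₀ + algebraMap A B a₁ * b₁ + algebraMap A B a₂ * b₂ +
        algebraMap A B a₃ * b₃ ∈ (maximalIdeal A).map (algebraMap A B) := by
  obtain ⟨a, ha, h⟩ := exists_isUnit_sum_mul_mem_map_maximalIdeal hrank ![b₀, b₁, b₂, b₃]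
  refine ⟨a 0, a 1, a 2, a 3, ?_, by simpa [Fin.sum_univ_four] using h⟩
  obtain ⟨i, hi⟩ := ha
  fin_cases i <;> simp_all

/-- If the residue class of b were new, then for x in m_B outside J the four elements 1, b, x, bx
would be independent modulo J. -/
lemma exists_sub_algebraMap_mem_maximalIdeal [IsLocalRing B]
    (hrank : Module.finrank A B < 4)
    (hlt : (maximalIdeal A).map (algebraMap A B) < maximalIdeal B) (b : B) :
    ∃ a : A, b - algebraMap A B a ∈ maximalIdeal B := by
  by_contra! hcon
  obtain ⟨x, hx, hxJ⟩ := SetLike.exists_of_lt hlt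
  have hlin : ∀ {p q : A}, algebraMap A B p + algebraMap A B q * b ∈ maximalIdeal B →
      ¬ IsUnit p ∧ ¬ IsUnit q := by
    intro p q hpq
    have hq : ¬ IsUnit q := by
      rintro ⟨u, rfl⟩
      refine hcon (-(↑u⁻¹ * p)) (mem_of_isUnit_of_algebraMap_mul_mem u.isUnit ?_)
      rw [mul_sub, ← map_mul, mul_neg, Units.mul_inv_cancel_left, map_neg]
      convert hpq using 1
      ring
    refine ⟨not_isUnit_of_algebraMap_mem (B := B) ?_, hq⟩
    exact (Ideal.add_mem_iff_left _
      (Ideal.mul_mem_right _ _ (hlt.le (algebraMap_mem_map_maximalIdeal hq)))).mp hpq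
  obtain ⟨a₀, a₁, a₂, a₃, hu, h⟩ := exists_isUnit_or_relation hrank 1 b x (b * x)
  obtain ⟨h0, h1⟩ : ¬ IsUnit a₀ ∧ ¬ IsUnit a₁ := by
    refine hlin ?_
    have := sub_mem (hlt.le h) (Ideal.mul_mem_left _ (algebraMap A B a₂ + algebraMap A B a₃ * b) hx)
    convert this using 1
    ring
  obtain ⟨h2, h3⟩ : ¬ IsUnit a₂ ∧ ¬ IsUnit a₃ := by
    refine hlin ?_
    by_contra hun
    rw [mem_maximalIdeal, mem_nonunits_iff, not_not] at hun
    refine hxJ ((Ideal.unit_mul_mem_iff_mem _ hun).mp ?_)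
    have := sub_mem h (add_mem (algebraMap_mem_map_maximalIdeal (B := B) h0)
      (Ideal.mul_mem_right b _ (algebraMap_mem_map_maximalIdeal (B := B) h1)))
    convert this using 1
    ring
  tauto

/-- Two elements x, y of m_B independent modulo J + m_B^2 already make 1, x, y a basis of B/J. So
they span m_B modulo J, and nothing is left for m_B^2. -/
lemma exists_sq_le_and_sup_span_pair_eq [IsLocalRing B] [IsNoetherianRing B]
    (hrank : Module.finrank A B < 4)
    (hlt : (maximalIdeal A).map (algebraMap A B) < maximalIdeal B)
    (hz : ∀ z, (maximalIdeal A).map (algebraMap A B) ⊔ Ideal.span {z} ≠ maximalIdeal B) :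
    maximalIdeal B ^ 2 ≤ (maximalIdeal A).map (algebraMap A B) ∧
      ∃ x y, (maximalIdeal A).map (algebraMap A B) ⊔ Ideal.span {x, y} = maximalIdeal B := by
  set J := (maximalIdeal A).map (algebraMap A B) with hJ
  have nak : ∀ {I : Ideal B}, I ≤ maximalIdeal B → maximalIdeal B ≤ I ⊔ maximalIdeal B ^ 2 →
      I = maximalIdeal B := fun hI h ↦ le_antisymm hI <|
    Submodule.le_of_le_smul_of_le_jacobson_bot (I := maximalIdeal B)
      (maximalIdeal B).fg_of_isNoetherianRing (maximalIdeal_le_jacobson _)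
      (by rwa [smul_eq_mul, ← pow_two])
  obtain ⟨x, hx, hxJ⟩ := SetLike.not_le_iff_exists.mp fun h ↦ hlt.ne (nak hlt.le h)
  have hxm : J ⊔ Ideal.span {x} ≤ maximalIdeal B :=
    sup_le hlt.le ((Ideal.span_singleton_le_iff_mem _).mpr hx)
  obtain ⟨y, hy, hyJ⟩ := SetLike.not_le_iff_exists.mp fun h ↦ hz x (nak hxm h)
  have hind : ∀ {p q : A} {w : B}, w ∈ J ⊔ maximalIdeal B ^ 2 →
      algebraMap A B p * x + algebraMap A B q * y + w ∈ J →
      ¬ IsUnit p ∧ ¬ IsUnit q := by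
    intro p q w hw h
    have hle : J ⊔ maximalIdeal B ^ 2 ≤ J ⊔ Ideal.span {x} ⊔ maximalIdeal B ^ 2 :=
      sup_le_sup_right le_sup_left _
    have hq : ¬ IsUnit q := by
      intro hq
      refine hyJ (mem_of_isUnit_of_algebraMap_mul_mem hq ?_)
      have hx' : x ∈ J ⊔ Ideal.span {x} ⊔ maximalIdeal B ^ 2 :=
        Ideal.mem_sup_left (Ideal.mem_sup_right (Ideal.mem_span_singleton_self x))
      have := sub_mem (sub_mem (hle (Ideal.mem_sup_left h)) (hle hw))
        (Ideal.mul_mem_left _ (algebraMap A B p) hx')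
      convert this using 1
      ring
    refine ⟨fun hp ↦ hxJ (mem_of_isUnit_of_algebraMap_mul_mem hp ?_), hq⟩
    have := sub_mem (sub_mem (Ideal.mem_sup_left h) hw)
      (Ideal.mem_sup_left (Ideal.mul_mem_right y _ (algebraMap_mem_map_maximalIdeal (B := B) hq)))
    convert this using 1
    ring
  have hrel : ∀ {u : B}, u ∈ maximalIdeal B → ∃ p q r : A, (IsUnit p ∨ IsUnit q ∨ IsUnit r) ∧
      algebraMap A B p * x + algebraMap A B q * y + algebraMap A B r * u ∈ J := by
    intro u hu
    obtain ⟨a₀, a₁, a₂, a₃, hun, h⟩ := exists_isUnit_or_relation hrank 1 x y u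
    have h0 : ¬ IsUnit a₀ := by
      refine not_isUnit_of_algebraMap_mem (B := B) ?_
      have := sub_mem (hlt.le h) (add_mem (add_mem (Ideal.mul_mem_left _ (algebraMap A B a₁) hx)
        (Ideal.mul_mem_left _ (algebraMap A B a₂) hy)) (Ideal.mul_mem_left _ (algebraMap A B a₃) hu))
      convert this using 1
      ring
    refine ⟨a₁, a₂, a₃, hun.resolve_left h0, ?_⟩
    have := sub_mem h (algebraMap_mem_map_maximalIdeal (B := B) h0)
    convert this using 1
    ring
  refine ⟨fun w hw ↦ ?_, x, y, le_antisymm (sup_le hlt.le ?_) fun u hu ↦ ?_⟩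
  · obtain ⟨p, q, r, hun, h⟩ := hrel (Ideal.pow_le_self two_ne_zero hw)
    obtain ⟨hp, hq⟩ := hind (Ideal.mem_sup_right (Ideal.mul_mem_left _ _ hw)) h
    refine mem_of_isUnit_of_algebraMap_mul_mem ((hun.resolve_left hp).resolve_left hq) ?_
    have := sub_mem h (add_mem
      (Ideal.mul_mem_right x _ (algebraMap_mem_map_maximalIdeal (B := B) hp))
      (Ideal.mul_mem_right y _ (algebraMap_mem_map_maximalIdeal (B := B) hq)))
    convert this using 1
    ring
  · rw [Ideal.span_le]
    rintro _ (rfl | rfl)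
    exacts [hx, hy]
  · obtain ⟨p, q, r, hun, h⟩ := hrel hu
    have hr : IsUnit r := by
      by_contra hr
      obtain ⟨hp, hq⟩ := hind (Ideal.mem_sup_left
        (Ideal.mul_mem_right _ _ (algebraMap_mem_map_maximalIdeal (B := B) hr))) h
      tauto
    refine mem_of_isUnit_of_algebraMap_mul_mem hr ?_
    have hpq : algebraMap A B p * x + algebraMap A B q * y ∈ Ideal.span {x, y} :=
      Ideal.mem_span_pair.mpr ⟨_, _, rfl⟩
    have := sub_mem (Ideal.mem_sup_left h) (Ideal.mem_sup_right (S := J) hpq)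
    convert this using 1
    ring

end Monogenic

/-- A finite free extension of regular local rings of the same dimension and of rank at most three
is monogenic. -/
theorem IsRegularLocalRing.exists_adjoin_singleton_eq_top_of_finrank_le_three
    {A B : Type*} [CommRing A] [CommRing B] [Algebra A B] [Module.Finite A B] [Module.Free A B]
    [IsRegularLocalRing A] [IsRegularLocalRing B] [FaithfulSMul A B]
    (hrank : Module.finrank A B ≤ 3) : ∃ β : B, Algebra.adjoin A {β} = ⊤ := by
  have hle : (maximalIdeal A).map (algebraMap A B) ≤ maximalIdeal B :=
    Ideal.map_le_iff_le_comap.mpr fun a ha ↦ (mem_maximalIdeal _).mpr fun hu ↦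
      (mem_maximalIdeal _).mp ha (isUnit_of_map_unit _ _ hu)
  rcases hle.eq_or_lt with heq | hlt
  · refine exists_adjoin_singleton_eq_top_of_isMaximal (heq ▸ inferInstance) ?_
    have := isDomain (R := A)
    have hpos : 0 < Module.finrank A B := Module.finrank_pos
    interval_cases Module.finrank A B
    exacts [.inl rfl, .inr Nat.prime_two, .inr Nat.prime_three]
  · have hres := exists_sub_algebraMap_mem_maximalIdeal (Nat.lt_succ_of_le hrank) hlt
    obtain ⟨z, hz⟩ : ∃ z, (maximalIdeal A).map (algebraMap A B) ⊔ Ideal.span {z} =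
        maximalIdeal B := by
      by_contra! hcon
      obtain ⟨hsq, x, y, hxy⟩ :=
        exists_sq_le_and_sup_span_pair_eq (Nat.lt_succ_of_le hrank) hlt hcon
      obtain ⟨n, hn⟩ := exists_ringKrullDim_eq (R := B)
      obtain ⟨s, hs, hcard⟩ := exists_finset_span_eq_maximalIdeal (R := A)
      classical
      have hspan : Ideal.span ((s.image (algebraMap A B) : Finset B) : Set B) =
          (maximalIdeal A).map (algebraMap A B) := by
        rw [← hs, Ideal.map_span, Finset.coe_image]
      have hcard' : (s.image (algebraMap A B)).card ≤ n := by
        refine Finset.card_image_le.trans ?_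
        have := ringKrullDim_le_of_hasGoingUp (A := A) (B := B)
        rw [← hcard, hn] at this
        exact_mod_cast this
      rw [← hspan] at hsq hxy
      obtain ⟨z, hz⟩ := exists_sup_span_singleton_eq_maximalIdeal hn hcard' hsq hxy
      exact hcon z (hspan ▸ hz)
    exact ⟨z, Algebra.adjoin_singleton_eq_top_of_sup_span_eq hz hres⟩

/-! ### The trace embedding and the augmentation ideal. -/

section Invariants

variable {G B : Type*} [Group G] [CommRing B] [MulSemiringAction G B]

instance FixedPoints.isInvariant_subring : Algebra.IsInvariant (FixedPoints.subring B G) B G :=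
  ⟨fun b hb ↦ ⟨⟨b, hb⟩, rfl⟩⟩

/-- The map `b ↦ (∑ g, g • (b * c ^ j))_j` from a ring to a power of its ring of invariants. -/
noncomputable def traceVector (G : Type*) [Group G] [MulSemiringAction G B] [Fintype G] (c : B) :
    B →ₗ[FixedPoints.subring B G] Fin (Fintype.card G) → FixedPoints.subring B G where
  toFun b j := ⟨∑ g : G, g • (b * c ^ (j : ℕ)), fun h ↦ by
    rw [Finset.smul_sum]
    simp_rw [smul_smul]
    exact Fintype.sum_equiv (Equiv.mulLeft h) _ _ fun _ ↦ rfl⟩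
  map_add' x y := by
    ext j
    simp [add_mul, Finset.sum_add_distrib]
  map_smul' a x := by
    ext j
    have ha : ∀ g : G, g • (a : B) = a := a.2
    simp [Finset.mul_sum, Subring.smul_def, ha, mul_assoc]

/-- The coordinates are the sums of g(b) g(c)^j, a Vandermonde system in the distinct conjugates of
c, so vanishing forces every g(b) to be zero. -/
lemma traceVector_injective [IsDomain B] [Fintype G] {c : B}
    (hc : Function.Injective fun g : G ↦ g • c) : Function.Injective (traceVector G c) := by
  rw [← LinearMap.ker_eq_bot, LinearMap.ker_eq_bot']
  intro b hb
  let e := (Fintype.equivFin G).symm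
  have h0 : (fun i ↦ e i • b) = 0 := by
    refine Matrix.eq_zero_of_forall_pow_sum_mul_pow_eq_zero (f := fun i ↦ e i • c)
      (hc.comp e.injective) fun j ↦ ?_
    have hj : ∑ g : G, g • (b * c ^ (j : ℕ)) = 0 := congr_arg Subtype.val (congr_fun hb j)
    rw [← hj, ← e.sum_comp]
    simp
  have := congr_fun h0 (e.symm 1)
  simpa using this

lemma injective_smul_of_prime_card {p : ℕ} [hp : Fact p.Prime] (hG : Nat.card G = p) {σ : G}
    {c : B} (hc : σ • c ≠ c) : Function.Injective fun g : G ↦ g • c := by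
  have hbot : MulAction.stabilizer G c = ⊥ := by
    have : Fact (Nat.card G).Prime := hG ▸ hp
    refine ((MulAction.stabilizer G c).eq_bot_or_eq_top_of_prime_card).resolve_right fun h ↦ hc ?_
    exact MulAction.mem_stabilizer_iff.mp (h ▸ Subgroup.mem_top σ)
  intro g h hgh
  have : h⁻¹ * g ∈ MulAction.stabilizer G c := by
    rw [MulAction.mem_stabilizer_iff, mul_smul, inv_smul_eq_iff]
    exact hgh
  rw [hbot, Subgroup.mem_bot, inv_mul_eq_one] at this
  exact this.symm

/-- σ - 1 kills A and satisfies σ(xy) - xy = σ(x)(σ(y) - y) + (σ(x) - x)y, so its values on A[β]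
stay in the ideal generated by its value at β. -/
lemma augmentationIdeal_eq_span_of_adjoin_eq_top (σ : G) {β : B}
    (hβ : Algebra.adjoin (FixedPoints.subring B G) {β} = ⊤) :
    augmentationIdeal B σ = Ideal.span {augmentationMap B σ β} := by
  refine le_antisymm (Ideal.span_le.mpr ?_)
    (Ideal.span_mono (Set.singleton_subset_iff.mpr ⟨β, rfl⟩))
  rintro _ ⟨b, rfl⟩
  have hb : b ∈ Algebra.adjoin (FixedPoints.subring B G) {β} := hβ ▸ Algebra.mem_top
  simp only [augmentationMap, SetLike.mem_coe]
  induction hb using Algebra.adjoin_induction with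
  | mem x hx =>
    obtain rfl := hx
    exact Ideal.mem_span_singleton_self _
  | algebraMap r =>
    have : σ • (r : B) = r := r.2 σ
    rw [show algebraMap (FixedPoints.subring B G) B r = r from rfl, this, sub_self]
    exact zero_mem _
  | add x y _ _ hx hy =>
    rw [smul_add, add_sub_add_comm]
    exact add_mem hx hy
  | mul x y _ _ hx hy =>
    have : σ • (x * y) - x * y = σ • x * (σ • y - y) + (σ • x - x) * y := by
      rw [smul_mul']
      ring
    rw [this]
    exact add_mem (Ideal.mul_mem_left _ _ hy) (Ideal.mul_mem_right _ _ hx)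

end Invariants

theorem mainTheorem4 {B : Type*} [CommRing B] [IsRegularLocalRing B]
    {G : Type*} [Group G] [MulSemiringAction G B]
    (p : ℕ) (hp : p = 2 ∨ p = 3) (hG : Nat.card G = p)
    (σ : G) (hσ : ∀ g : G, g ∈ Subgroup.zpowers σ)
    (hA : IsRegularLocalRing (FixedPoints.subring B G)) :
    (augmentationIdeal B σ).IsPrincipal := by
  -- The action need not be faithful; the trace embedding requires an element moved by σ.
  by_cases htriv : ∀ b : B, σ • b = b
  · have : augmentationIdeal B σ = ⊥ := by
      simp [augmentationIdeal, augmentationMap, htriv]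
    rw [this]
    infer_instance
  push Not at htriv
  obtain ⟨c, hc⟩ := htriv
  have hprime : Fact p.Prime := ⟨by rcases hp with rfl | rfl <;> norm_num⟩
  have : Finite G := Nat.finite_of_card_ne_zero (hG ▸ hprime.out.ne_zero)
  have := Fintype.ofFinite G
  have := IsRegularLocalRing.isDomain (R := B)
  -- This embedding into A^p gives both finiteness, as A is noetherian, and the bound p on the rank.
  have hinj := traceVector_injective (injective_smul_of_prime_card hG hc)
  have : Module.Finite (FixedPoints.subring B G) B := Module.Finite.of_injective _ hinj
  have : Module.Free (FixedPoints.subring B G) B := IsRegularLocalRing.free_of_finite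
  have hrank : Module.finrank (FixedPoints.subring B G) B ≤ 3 := by
    refine (LinearMap.finrank_le_finrank_of_injective hinj).trans ?_
    rw [Module.finrank_fin_fun, ← Nat.card_eq_fintype_card, hG]
    omega
  obtain ⟨β, hβ⟩ := IsRegularLocalRing.exists_adjoin_singleton_eq_top_of_finrank_le_three hrank
  exact ⟨⟨_, augmentationIdeal_eq_span_of_adjoin_eq_top σ hβ⟩⟩
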